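/- Let $\mathcal S$ be a relational schema with a (possibly infinite) set of constants $\mathcal U$, finitely many database predicates $P\in\mathcal S$, and built-in predicates; let $D$ be a database instance (a finite set of ground atoms $P(\bar a)$, $\bar a$ a tuple over $\mathcal U$), and let $IC$ be a finite set of universal integrity constraints of the form $\forall\bar x\,(\bigwedge_{i} P_i(\bar x_i)\to\bigvee_{j} Q_j(\bar y_j)\vee\varphi)$, where the $P_i,Q_j$ are database predicates and $\varphi$ is a disjunction of built-in literals (equality included). For each $P\in\mathcal S$ let $P_t,P_f,P_\star,P_{\star\star}$ be new predicates of the same arity. The repair program $\Pi(IC,D)$ consists of the rules: 1. $P(\bar a)$, for each $P(\bar a)\in D$; 2. for each constraint in $IC$ and each partition of the set of its atoms $Q_j(\bar y_j)$ into $Q'$ and $Q''$: $$\bigvee_i P_{i,f}(\bar x_i)\vee\bigvee_j Q_{j,t}(\bar y_j)\leftarrow\bigwedge_i P_{i,\star}(\bar x_i),\ \bigwedge_{Q_j\in Q'}Q_{j,f}(\bar y_j),\ \bigwedge_{Q_k\in Q''}\mathit{not}\ Q_k(\bar y_k),\ \bar\varphi,$$ where $\bar\varphi$ is the conjunction of the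 complements of the literals of $\varphi$; 3. $P_\star(\bar x)\leftarrow P(\bar x)$ and $P_\star(\bar x)\leftarrow P_t(\bar x)$, for each $P\in\mathcal S$; 4. $P_{\star\star}(\bar x)\leftarrow P_\star(\bar x),\ \mathit{not}\ P_f(\bar x)$, for each $P\in\mathcal S$; 5. $\leftarrow P_t(\bar x),P_f(\bar x)$, for each $P\in\mathcal S$. A program is read as the first-order sentence $\psi$ that is the conjunction of the universal closures of the formulas $\mathit{Body}\to\mathit{Head}$, with $\mathit{not}\,A$ read as $A\to\bot$. Let $\Phi$ be the second-order stable-model sentence $\psi\wedge\neg\exists\bar X(\bar X<\bar P\wedge\psi^\circ(\bar X))$ of $\Pi(IC,D)$. Here $\bar P$ lists all predicates $P,P_t,P_f,P_\star,P_{\star\star}$ with $P\in\mathcal S$, $\bar X$ is a list of corresponding predicate variables, $\bar X<\bar P$ says that each $X^{p}$ is contained in $p$ and that at least one containment is proper, and $\psi^\circ(\bar X)$ is obtained by replacing each atom $p(\bar t)$ by $X^{p}(\bar t)$ for $p$ in $\bar P$, leaving equalities, built-in atoms and $\bot$ unchanged, commuting with $\wedge,\vee,\forall,\exists$, and setting $(F\to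 G)^\circ=(F^\circ\to G^\circ)\wedge(F\to G)$. Let $\Theta$ be the first-order sentence associated in this way to the rules 1-3. For a finite set $C\subseteq\mathcal U$ containing all constants that occur in $D$ (for instance the active domain of $D$, or $\mathcal U$ itself if it is finite), let $\mathcal R(D)$ be Reiter's reconstruction of $D$ over $C$: the conjunction of the domain closure axiom $\mathrm{DCA}$ ($\forall x\bigvee_{c\in C}x=c$), the unique names axiom $\mathrm{UNA}$ ($c\neq c'$ for distinct $c,c'\in C$), and the predicate completion $\mathrm{PC}(D)$, i.e. $\forall\bar x\,(P(\bar x)\equiv\bigvee_{P(\bar a)\in D}\bar x=\bar a)$ for each $P\in\mathcal S$. Then, under $\mathrm{DCA}$ and $\mathrm{UNA}$, the sentence $\Phi$ is equivalent to the sentence below; precisely, $\mathrm{DCA}\wedge\mathrm{UNA}\wedge\Phi$ is logically equivalent (in all structures with nonempty universe, under the standard second-order semantics) to $$\mathcal R(D)\wedge\bigwedge_{P\in\mathcal S}\forall\bar x\big((P(\bar x)\vee P_t(\bar x))\equiv P_\star(\bar x)\big)\wedge\bigwedge_{P\in\mathcal S}\forall\bar x\big((P_\star(\bar x)\wedge\neg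 P_f(\bar x))\equiv P_{\star\star}(\bar x)\big)\wedge\bigwedge_{P\in\mathcal S}\forall\bar x\,\neg(P_t(\bar x)\wedge P_f(\bar x))\wedge\mathit{Circ}(\Theta;\{P_t,P_f\mid P\in\mathcal S\};\{P_\star\mid P\in\mathcal S\}),$$ where $\mathit{Circ}(\Theta;\bar P;\bar Q)$ is the parallel circumscription $\Theta\wedge\neg\exists\bar X\bar Y(\Theta(\bar X,\bar Y)\wedge\bar X<\bar P)$ of the predicates $\bar P$ in $\Theta$ with the predicates $\bar Q$ varying and all other predicates fixed. Moreover, if $\mathrm{DCA}$ and $\mathrm{UNA}$ are omitted on both sides, i.e. $\mathcal R(D)$ is replaced by $\mathrm{PC}(D)$, then $\Phi$ itself is logically equivalent to the resulting conjunction in all structures, in particular in all Herbrand structures. -/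

import Mathlib

universe u v

namespace RepairSO

/-! ### First-order and second-order formulas -/

/-- A relational signature with constants. -/
structure Sig where
  Const : Type u
  Pred : Type u
  arity : Pred → ℕ

/-- Terms are variables or constants; `n` is the number of free variables in scope. -/
inductive Term (C : Type u) (n : ℕ) : Type u where
  | var : Fin n → Term C n
  | const : C → Term C n

/-- First-order formulas with equality and `n` free individual variables. The connectives
`⊥, ∧, ∨, →` and both quantifiers are primitive, and `¬ F` is `F → ⊥`. A quantifier binds the
variable `0`. -/
inductive FOForm (σ : Sig.{u}) : ℕ → Type u where
  | bot {n : ℕ} : FOForm σ n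
  | eq {n : ℕ} : Term σ.Const n → Term σ.Const n → FOForm σ n
  | pred {n : ℕ} (p : σ.Pred) : (Fin (σ.arity p) → Term σ.Const n) → FOForm σ n
  | and {n : ℕ} : FOForm σ n → FOForm σ n → FOForm σ n
  | or {n : ℕ} : FOForm σ n → FOForm σ n → FOForm σ n
  | imp {n : ℕ} : FOForm σ n → FOForm σ n → FOForm σ n
  | all {n : ℕ} : FOForm σ (n + 1) → FOForm σ n
  | ex {n : ℕ} : FOForm σ (n + 1) → FOForm σ n

/-- Second-order formulas. For every predicate symbol `p` there is a predicate variable `X^p` of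
the same arity; `pvar p ts` is the atom `X^p(ts)`, and `exP p F` is `∃ X^p F`. -/
inductive SOForm (σ : Sig.{u}) : ℕ → Type u where
  | bot {n : ℕ} : SOForm σ n
  | eq {n : ℕ} : Term σ.Const n → Term σ.Const n → SOForm σ n
  | pred {n : ℕ} (p : σ.Pred) : (Fin (σ.arity p) → Term σ.Const n) → SOForm σ n
  | pvar {n : ℕ} (p : σ.Pred) : (Fin (σ.arity p) → Term σ.Const n) → SOForm σ n
  | and {n : ℕ} : SOForm σ n → SOForm σ n → SOForm σ n
  | or {n : ℕ} : SOForm σ n → SOForm σ n → SOForm σ n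
  | imp {n : ℕ} : SOForm σ n → SOForm σ n → SOForm σ n
  | all {n : ℕ} : SOForm σ (n + 1) → SOForm σ n
  | ex {n : ℕ} : SOForm σ (n + 1) → SOForm σ n
  | exP {n : ℕ} (p : σ.Pred) : SOForm σ n → SOForm σ n

namespace FOForm

variable {σ : Sig.{u}}

def neg {n : ℕ} (F : FOForm σ n) : FOForm σ n := F.imp bot

def top {n : ℕ} : FOForm σ n := neg bot

def iff {n : ℕ} (F G : FOForm σ n) : FOForm σ n := (F.imp G).and (G.imp F)

/-- Finite conjunction. -/
def conj {n : ℕ} (L : List (FOForm σ n)) : FOForm σ n := L.foldr and top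

/-- Finite disjunction. -/
def disj {n : ℕ} (L : List (FOForm σ n)) : FOForm σ n := L.foldr or bot

/-- Universal closure. -/
def closeAll : {n : ℕ} → FOForm σ n → FOForm σ 0
  | 0, F => F
  | _ + 1, F => closeAll F.all

open Classical in
/-- Replaces every predicate `p` of the list `L` by the predicate variable `X^p`. -/
noncomputable def subst (L : List σ.Pred) : {n : ℕ} → FOForm σ n → SOForm σ n
  | _, bot => .bot
  | _, eq s t => .eq s t
  | _, pred p ts => if p ∈ L then .pvar p ts else .pred p ts
  | _, and F G => (subst L F).and (subst L G)
  | _, or F G => (subst L F).or (subst L G)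
  | _, imp F G => (subst L F).imp (subst L G)
  | _, all F => (subst L F).all
  | _, ex F => (subst L F).ex

/-- A first-order formula seen as a second-order formula. -/
noncomputable def toSO {n : ℕ} (F : FOForm σ n) : SOForm σ n := F.subst []

open Classical in
/-- The transformation `F ↦ F°(X)`, where `L` is the list of the circumscribed predicates. -/
noncomputable def circle (L : List σ.Pred) : {n : ℕ} → FOForm σ n → SOForm σ n
  | _, bot => .bot
  | _, eq s t => .eq s t
  | _, pred p ts => if p ∈ L then .pvar p ts else .pred p ts
  | _, and F G => (circle L F).and (circle L G)
  | _, or F G => (circle L F).or (circle L G)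
  | _, imp F G => ((circle L F).imp (circle L G)).and (F.toSO.imp G.toSO)
  | _, all F => (circle L F).all
  | _, ex F => (circle L F).ex

end FOForm

namespace SOForm

variable {σ : Sig.{u}}

def neg {n : ℕ} (F : SOForm σ n) : SOForm σ n := F.imp bot

def conj {n : ℕ} (L : List (SOForm σ n)) : SOForm σ n := L.foldr and (neg bot)

def disj {n : ℕ} (L : List (SOForm σ n)) : SOForm σ n := L.foldr or bot

def closeAll : {n : ℕ} → SOForm σ n → SOForm σ 0
  | 0, F => F
  | _ + 1, F => closeAll F.all

def closeEx : {n : ℕ} → SOForm σ n → SOForm σ 0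
  | 0, F => F
  | _ + 1, F => closeEx F.ex

/-- `∃ X^{p₁} ⋯ ∃ X^{pₖ} F` for a list `p₁, …, pₖ` of predicates. -/
def exPs {n : ℕ} (L : List σ.Pred) (F : SOForm σ n) : SOForm σ n := L.foldr exP F

/-- `∀ x̄ (X^p(x̄) → p(x̄))`. -/
def leAt (p : σ.Pred) : SOForm σ 0 := closeAll ((pvar p Term.var).imp (pred p Term.var))

/-- `∃ x̄ (p(x̄) ∧ ¬ X^p(x̄))`. -/
def neAt (p : σ.Pred) : SOForm σ 0 :=
  closeEx ((pred p Term.var).and (neg (pvar p Term.var)))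

/-- `X̄ < P̄`: every `X^p` is included in `p`, and some inclusion is strict. -/
def ltPreds (L : List σ.Pred) : SOForm σ 0 := (conj (L.map leAt)).and (disj (L.map neAt))

end SOForm

/-- The second-order stable-model sentence `ψ ∧ ¬ ∃ X̄ (X̄ < P̄ ∧ ψ°(X̄))`, where `P̄` is the list
of the circumscribed predicates. -/
noncomputable def stable {σ : Sig.{u}} (ψ : FOForm σ 0) (L : List σ.Pred) : SOForm σ 0 :=
  ψ.toSO.and (SOForm.neg (SOForm.exPs L ((SOForm.ltPreds L).and (ψ.circle L))))

/-- Parallel circumscription of the predicates `Ps` in `Θ` with the predicates `Qs` varying: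
`Θ(P̄, Q̄) ∧ ¬ ∃ X̄ Ȳ (Θ(X̄, Ȳ) ∧ X̄ < P̄)`. -/
noncomputable def parCirc {σ : Sig.{u}} (Θ : FOForm σ 0) (Ps Qs : List σ.Pred) : SOForm σ 0 :=
  Θ.toSO.and
    (SOForm.neg (SOForm.exPs (Ps ++ Qs) ((Θ.subst (Ps ++ Qs)).and (SOForm.ltPreds Ps))))

/-! ### Semantics -/

/-- A structure with universe `A`. -/
structure Struc (σ : Sig.{u}) (A : Type v) where
  const : σ.Const → A
  pred : (p : σ.Pred) → (Fin (σ.arity p) → A) → Prop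

def Term.val {σ : Sig.{u}} {A : Type v} (M : Struc σ A) {n : ℕ} (e : Fin n → A) :
    Term σ.Const n → A
  | .var i => e i
  | .const c => M.const c

open Classical in
/-- Satisfaction in the standard second-order semantics: predicate variables range over all
relations on the universe. `X` interprets the predicate variables and `e` the individual ones. -/
def SOForm.Sat {σ : Sig.{u}} {A : Type v} (M : Struc σ A) :
    {n : ℕ} → ((p : σ.Pred) → (Fin (σ.arity p) → A) → Prop) → (Fin n → A) → SOForm σ n → Prop
  | _, _, _, .bot => False
  | _, _, e, .eq s t => s.val M e = t.val M e
  | _, _, e, .pred p ts => M.pred p (fun i => (ts i).val M e)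
  | _, X, e, .pvar p ts => X p (fun i => (ts i).val M e)
  | _, X, e, .and F G => F.Sat M X e ∧ G.Sat M X e
  | _, X, e, .or F G => F.Sat M X e ∨ G.Sat M X e
  | _, X, e, .imp F G => F.Sat M X e → G.Sat M X e
  | _, X, e, .all F => ∀ a : A, F.Sat M X (Fin.cons a e)
  | _, X, e, .ex F => ∃ a : A, F.Sat M X (Fin.cons a e)
  | _, X, e, .exP p F => ∃ R, F.Sat M (Function.update X p R) e

/-- Logical equivalence: the same truth value in every structure with a nonempty universe (for
every interpretation of the predicate variables, which is immaterial for sentences). -/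
def LogEquiv {σ : Sig.{u}} (F G : SOForm σ 0) : Prop :=
  ∀ (A : Type v) [Nonempty A] (M : Struc σ A) (X : (p : σ.Pred) → (Fin (σ.arity p) → A) → Prop),
    F.Sat M X Fin.elim0 ↔ G.Sat M X Fin.elim0

/-! ### Disjunctive programs -/

/-- Atoms; equality is a built-in that is used in rule bodies only. -/
inductive Atom (σ : Sig.{u}) (n : ℕ) : Type u where
  | eq : Term σ.Const n → Term σ.Const n → Atom σ n
  | pred (p : σ.Pred) : (Fin (σ.arity p) → Term σ.Const n) → Atom σ n

def Atom.form {σ : Sig.{u}} {n : ℕ} : Atom σ n → FOForm σ n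
  | .eq s t => .eq s t
  | .pred p ts => .pred p ts

/-- A rule `A₁ ∨ ⋯ ∨ Aₙ ← P₁, …, Pₘ, not N₁, …, not Nₖ` with variables in `Fin nvars`. -/
structure Rule (σ : Sig.{u}) where
  nvars : ℕ
  head : List (Atom σ nvars)
  pos : List (Atom σ nvars)
  neg : List (Atom σ nvars)

/-- The universal closure of `Body → Head`. -/
def Rule.form {σ : Sig.{u}} (r : Rule σ) : FOForm σ 0 :=
  FOForm.closeAll (FOForm.imp
    (FOForm.conj (r.pos.map Atom.form ++ r.neg.map (fun a => a.form.neg)))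
    (FOForm.disj (r.head.map Atom.form)))

/-- The first-order sentence `ψ` of a program. -/
def progForm {σ : Sig.{u}} (prog : List (Rule σ)) : FOForm σ 0 :=
  FOForm.conj (prog.map Rule.form)

/-! ### Databases, integrity constraints, repair programs -/

/-- A relational schema: a domain of constants, finitely many database predicates (`Fin numRel`),
and built-in predicates. -/
structure Schema where
  Const : Type u
  numRel : ℕ
  arity : Fin numRel → ℕ
  BuiltIn : Type u
  builtInArity : BuiltIn → ℕ

/-- The copies `P, P_t, P_f, P⋆, P⋆⋆` of a database predicate `P`. -/
inductive Ann where
  | base | t | f | star | dstar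

/-- The predicates of repair programs: the copies `P_a` of the database predicates, and the
built-ins. -/
inductive RPred (S : Schema.{u}) : Type u where
  | ann : Ann → Fin S.numRel → RPred S
  | builtIn : S.BuiltIn → RPred S

@[reducible]
def RPred.arity {S : Schema.{u}} : RPred S → ℕ
  | .ann _ P => S.arity P
  | .builtIn b => S.builtInArity b

/-- The signature of repair programs over a schema. -/
@[reducible]
def Schema.sig (S : Schema.{u}) : Sig.{u} where
  Const := S.Const
  Pred := RPred S
  arity := RPred.arity

/-- A database instance: a finite extension for every database predicate. -/
abbrev Instance (S : Schema.{u}) := (P : Fin S.numRel) → Finset (Fin (S.arity P) → S.Const)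

/-- Database atoms `P(t̄)` with variables in `Fin n`. -/
structure DBAtom (S : Schema.{u}) (n : ℕ) where
  rel : Fin S.numRel
  args : Fin (S.arity rel) → Term S.Const n

/-- The atom `P_a(t̄)` for an annotation `a`. -/
def DBAtom.ann {S : Schema.{u}} {n : ℕ} (a : Ann) (q : DBAtom S n) : Atom S.sig n :=
  .pred (σ := S.sig) (RPred.ann a q.rel) q.args

/-- Built-in atoms, including equalities. -/
inductive BAtom (S : Schema.{u}) (n : ℕ) where
  | eq : Term S.Const n → Term S.Const n → BAtom S n
  | builtIn (b : S.BuiltIn) : (Fin (S.builtInArity b) → Term S.Const n) → BAtom S n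

def BAtom.atom {S : Schema.{u}} {n : ℕ} : BAtom S n → Atom S.sig n
  | .eq s t => .eq s t
  | .builtIn b ts => .pred (σ := S.sig) (RPred.builtIn b) ts

/-- A universal integrity constraint `∀ x̄ (⋀ Pᵢ(x̄ᵢ) → ⋁ Qⱼ(ȳⱼ) ∨ φ)`: `body` lists the
`Pᵢ(x̄ᵢ)`, `head` lists the `Qⱼ(ȳⱼ)`, and `φ` is the disjunction of the built-in atoms in `phiPos`
and of the negations of the built-in atoms in `phiNeg`. -/
structure IC (S : Schema.{u}) where
  nvars : ℕ
  body : List (DBAtom S nvars)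
  head : List (DBAtom S nvars)
  phiPos : List (BAtom S nvars)
  phiNeg : List (BAtom S nvars)

/-- All ways of splitting a list into two complementary sublists `(Q', Q'')`. -/
def splits {α : Type u} : List α → List (List α × List α)
  | [] => [([], [])]
  | q :: qs => (splits qs).flatMap (fun s => [(q :: s.1, s.2), (s.1, q :: s.2)])

/-- The rules
`⋁ Pᵢ_f(x̄ᵢ) ∨ ⋁ Qⱼ_t(ȳⱼ) ← ⋀ Pᵢ⋆(x̄ᵢ), ⋀_{Q'} Qⱼ_f(ȳⱼ), ⋀_{Q''} not Qₖ(ȳₖ), ¬φ`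
of a constraint, one for every split `(Q', Q'')` of the atoms `Qⱼ(ȳⱼ)`. The conjunction `¬φ` of
built-in literals has its atoms in `phiNeg` and the negations of those in `phiPos`. -/
def IC.rules {S : Schema.{u}} (ic : IC S) : List (Rule S.sig) :=
  (splits ic.head).map fun s =>
    { nvars := ic.nvars
      head := ic.body.map (DBAtom.ann .f) ++ ic.head.map (DBAtom.ann .t)
      pos := ic.body.map (DBAtom.ann .star) ++ s.1.map (DBAtom.ann .f) ++ ic.phiNeg.map BAtom.atom
      neg := s.2.map (DBAtom.ann .base) ++ ic.phiPos.map BAtom.atom }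

/-- The facts `P(ā)` for `P(ā) ∈ D`. -/
noncomputable def factRules {S : Schema.{u}} (D : Instance S) : List (Rule S.sig) :=
  (List.finRange S.numRel).flatMap fun P => (D P).toList.map fun a =>
    { nvars := 0
      head := [.pred (σ := S.sig) (RPred.ann .base P) (fun i => .const (a i))]
      pos := []
      neg := [] }

/-- The atom `P_a(x̄)` with `x̄` a tuple of distinct variables. -/
def Schema.gen (S : Schema.{u}) (a : Ann) (P : Fin S.numRel) : Atom S.sig (S.arity P) :=
  .pred (σ := S.sig) (RPred.ann a P) Term.var

/-- `P⋆(x̄) ← P(x̄)` and `P⋆(x̄) ← P_t(x̄)` for every database predicate `P`. -/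
def starRules (S : Schema.{u}) : List (Rule S.sig) :=
  (List.finRange S.numRel).flatMap fun P =>
    [{ nvars := S.arity P, head := [S.gen .star P], pos := [S.gen .base P], neg := [] },
     { nvars := S.arity P, head := [S.gen .star P], pos := [S.gen .t P], neg := [] }]

/-- `P⋆⋆(x̄) ← P⋆(x̄), not P_f(x̄)` for every database predicate `P`. -/
def dstarRules (S : Schema.{u}) : List (Rule S.sig) :=
  (List.finRange S.numRel).map fun P =>
    { nvars := S.arity P, head := [S.gen .dstar P], pos := [S.gen .star P], neg := [S.gen .f P] }

/-- The program constraints `← P_t(x̄), P_f(x̄)` for every database predicate `P`. -/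
def denialRules (S : Schema.{u}) : List (Rule S.sig) :=
  (List.finRange S.numRel).map fun P =>
    { nvars := S.arity P, head := [], pos := [S.gen .t P, S.gen .f P], neg := [] }

/-- The rules that are relevant to compute the predicates `P_t, P_f`: the facts, the rules of the
constraints, and the rules for the predicates `P⋆`. -/
noncomputable def coreRules {S : Schema.{u}} (ics : List (IC S)) (D : Instance S) :
    List (Rule S.sig) :=
  factRules D ++ ics.flatMap IC.rules ++ starRules S

/-- The repair program `Π(IC, D)`. -/
noncomputable def repairProgram {S : Schema.{u}} (ics : List (IC S)) (D : Instance S) :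
    List (Rule S.sig) :=
  coreRules ics D ++ dstarRules S ++ denialRules S

/-- The list of all predicates with an annotation in `as`. -/
def Schema.annPreds (S : Schema.{u}) (as : List Ann) : List (RPred S) :=
  (List.finRange S.numRel).flatMap fun P => as.map fun a => RPred.ann a P

/-- The second-order stable-model sentence `Φ` of the repair program. All predicates of the
program except the built-ins are circumscribed. -/
noncomputable def repairSentence {S : Schema.{u}} (ics : List (IC S)) (D : Instance S) :
    SOForm S.sig 0 :=
  stable (progForm (repairProgram ics D)) (S.annPreds [.base, .t, .f, .star, .dstar])

/-! ### The parts of the characterization -/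

/-- Domain closure axiom `∀ x ⋁_{c ∈ C} x = c`. -/
noncomputable def domainClosure (S : Schema.{u}) (C : Finset S.Const) : FOForm S.sig 0 :=
  FOForm.all (FOForm.disj (C.toList.map fun c => .eq (.var 0) (.const c)))

open Classical in
/-- Unique names axiom `⋀ c ≠ c'` for distinct `c, c' ∈ C`. -/
noncomputable def uniqueNames (S : Schema.{u}) (C : Finset S.Const) : FOForm S.sig 0 :=
  FOForm.conj (C.offDiag.toList.map fun c => FOForm.neg (.eq (.const c.1) (.const c.2)))

/-- Predicate completion `⋀_P ∀ x̄ (P(x̄) ≡ ⋁_{P(ā) ∈ D} x̄ = ā)`. -/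
noncomputable def completion {S : Schema.{u}} (D : Instance S) : FOForm S.sig 0 :=
  FOForm.conj ((List.finRange S.numRel).map fun P =>
    FOForm.closeAll (FOForm.iff (S.gen .base P).form
      (FOForm.disj ((D P).toList.map fun a =>
        FOForm.conj ((List.finRange (S.arity P)).map fun i => .eq (.var i) (.const (a i)))))))

/-- Reiter's reconstruction `R(D)` over the finite set `C` of constants. -/
noncomputable def reconstruction {S : Schema.{u}} (D : Instance S) (C : Finset S.Const) :
    FOForm S.sig 0 :=
  (domainClosure S C).and ((uniqueNames S C).and (completion D))

/-- `⋀_P ∀ x̄ (P(x̄) ∨ P_t(x̄) ≡ P⋆(x̄))`. -/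
def starDef (S : Schema.{u}) : FOForm S.sig 0 :=
  FOForm.conj ((List.finRange S.numRel).map fun P => FOForm.closeAll
    (FOForm.iff ((S.gen .base P).form.or (S.gen .t P).form) (S.gen .star P).form))

/-- `⋀_P ∀ x̄ (P⋆(x̄) ∧ ¬ P_f(x̄) ≡ P⋆⋆(x̄))`. -/
def dstarDef (S : Schema.{u}) : FOForm S.sig 0 :=
  FOForm.conj ((List.finRange S.numRel).map fun P => FOForm.closeAll
    (FOForm.iff ((S.gen .star P).form.and (S.gen .f P).form.neg) (S.gen .dstar P).form))

/-- `⋀_P ∀ x̄ ¬ (P_t(x̄) ∧ P_f(x̄))`. -/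
def denials (S : Schema.{u}) : FOForm S.sig 0 :=
  FOForm.conj ((List.finRange S.numRel).map fun P => FOForm.closeAll
    (FOForm.neg ((S.gen .t P).form.and (S.gen .f P).form)))

/-- The parallel circumscription `Circ(Θ; {P_t, P_f}; {P⋆})`. -/
noncomputable def repairCirc {S : Schema.{u}} (ics : List (IC S)) (D : Instance S) :
    SOForm S.sig 0 :=
  parCirc (progForm (coreRules ics D)) (S.annPreds [.t, .f]) (S.annPreds [.star])

end RepairSO

/-!
`F°(X)` is evaluated like `F` in the logic of here-and-there: a pair `Y ≤ Z` of interpretations, in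
which an implication has to hold at `Y` ("here") and at `Z` ("there"). On a rule this amounts to the
usual reduct, in which the negated atoms are read in `Z` and all the others in `Y`
(`FOForm.ht_ruleForm`); the classical reading is the diagonal `Y = Z`. So `Φ` says that the
predicates `Z` of the structure satisfy the program and that no `Y < Z` satisfies its reduct at `Z`,
and the circumscription is put in the same form.

In the constraint rules `P` occurs only under negation, `P⋆` only positively in bodies, and `P⋆⋆` not
at all. So these rules survive in the reduct when the extension of `P`, `P⋆` or `P⋆⋆` is shrunk
(`RuleSat.of_icRules`).

* In a stable model, `P` can therefore be shrunk to `D`, `P⋆` to `P ∪ P_t` and `P⋆⋆` to `P⋆ ∖ P_f`,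
  and minimality forces the completion and the two definitions. A smaller pair `(P_t, P_f)` as in
  the circumscription gives, with `P⋆ := P ∪ P_t` and `P`, `P⋆⋆` unchanged, a smaller model of the
  reduct.
* Conversely, a model `X` of the reduct below the structure contains the facts, so it agrees with the
  structure on `P`. By the circumscription it agrees on `P_t` and `P_f`, and then the definitions of
  `P⋆` and `P⋆⋆` force agreement on these too.

The argument works in every structure, and the version under domain closure and unique names is an
immediate consequence.
-/

namespace RepairSO

/-! ### Here-and-there semantics -/

/-- Interpretations of the predicate symbols, or of the predicate variables, over a universe. -/
abbrev Interp (σ : Sig.{u}) (A : Type v) := (p : σ.Pred) → (Fin (σ.arity p) → A) → Prop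

/-- Satisfaction at the world `Y` ("here") of the here-and-there interpretation `(Y, Z)`; the
structure `M` only interprets the constants. Classical satisfaction in `Z` is `HT M Z Z`. -/
def FOForm.HT {σ : Sig.{u}} {A : Type v} (M : Struc σ A) (Z : Interp σ A) :
    {n : ℕ} → Interp σ A → (Fin n → A) → FOForm σ n → Prop
  | _, _, _, .bot => False
  | _, _, e, .eq s t => s.val M e = t.val M e
  | _, Y, e, .pred p ts => Y p (fun i => (ts i).val M e)
  | _, Y, e, .and F G => F.HT M Z Y e ∧ G.HT M Z Y e
  | _, Y, e, .or F G => F.HT M Z Y e ∨ G.HT M Z Y e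
  | _, Y, e, .imp F G => (F.HT M Z Y e → G.HT M Z Y e) ∧ (F.HT M Z Z e → G.HT M Z Z e)
  | _, Y, e, .all F => ∀ a : A, F.HT M Z Y (Fin.cons a e)
  | _, Y, e, .ex F => ∃ a : A, F.HT M Z Y (Fin.cons a e)

open Classical in
/-- The interpretation that reads the predicates in `L` as the predicate variables and the others
as in `M`. -/
noncomputable def mix {σ : Sig.{u}} {A : Type v} (M : Struc σ A) (L : List σ.Pred)
    (X : Interp σ A) : Interp σ A :=
  fun p => if p ∈ L then X p else M.pred p

section Semantics

variable {σ : Sig.{u}} {A : Type v} {M : Struc σ A}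

theorem mix_of_mem {L : List σ.Pred} {X : Interp σ A} {p : σ.Pred} (h : p ∈ L) :
    mix M L X p = X p := if_pos h

theorem mix_of_notMem {L : List σ.Pred} {X : Interp σ A} {p : σ.Pred} (h : p ∉ L) :
    mix M L X p = M.pred p := if_neg h

theorem mix_nil (X : Interp σ A) : mix M [] X = M.pred := by
  funext p
  exact mix_of_notMem List.not_mem_nil

theorem FOForm.sat_subst (L : List σ.Pred) (X : Interp σ A) {n : ℕ} (F : FOForm σ n)
    (e : Fin n → A) : (F.subst L).Sat M X e ↔ F.HT M (mix M L X) (mix M L X) e := by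
  induction F with
  | bot => simp [subst, SOForm.Sat, HT]
  | eq s t => simp [subst, SOForm.Sat, HT]
  | pred p ts => by_cases h : p ∈ L <;> simp [subst, SOForm.Sat, HT, mix, h]
  | and F G hF hG => simp [subst, SOForm.Sat, HT, hF, hG]
  | or F G hF hG => simp [subst, SOForm.Sat, HT, hF, hG]
  | imp F G hF hG => simp [subst, SOForm.Sat, HT, hF, hG]
  | all F hF => simp [subst, SOForm.Sat, HT, hF]
  | ex F hF => simp [subst, SOForm.Sat, HT, hF]

theorem FOForm.sat_toSO (X : Interp σ A) {n : ℕ} (F : FOForm σ n) (e : Fin n → A) :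
    F.toSO.Sat M X e ↔ F.HT M M.pred M.pred e := by
  rw [toSO, sat_subst, mix_nil]

/-- `F°(X)` expresses satisfaction at the world "here" when the world "there" is the structure. -/
theorem FOForm.sat_circle (L : List σ.Pred) (X : Interp σ A) {n : ℕ} (F : FOForm σ n)
    (e : Fin n → A) : (F.circle L).Sat M X e ↔ F.HT M M.pred (mix M L X) e := by
  induction F with
  | bot => simp [circle, SOForm.Sat, HT]
  | eq s t => simp [circle, SOForm.Sat, HT]
  | pred p ts => by_cases h : p ∈ L <;> simp [circle, SOForm.Sat, HT, mix, h]
  | and F G hF hG => simp [circle, SOForm.Sat, HT, hF, hG]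
  | or F G hF hG => simp [circle, SOForm.Sat, HT, hF, hG]
  | imp F G hF hG => simp [circle, SOForm.Sat, HT, hF, hG, sat_toSO]
  | all F hF => simp [circle, SOForm.Sat, HT, hF]
  | ex F hF => simp [circle, SOForm.Sat, HT, hF]

variable {Z Y : Interp σ A}

theorem FOForm.ht_conj {n : ℕ} (l : List (FOForm σ n)) (e : Fin n → A) :
    (conj l).HT M Z Y e ↔ ∀ F ∈ l, F.HT M Z Y e := by
  induction l with
  | nil => simp [conj, top, neg, HT]
  | cons F l ih => simp only [conj] at ih; simp [conj, HT, ih]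

theorem FOForm.ht_disj {n : ℕ} (l : List (FOForm σ n)) (e : Fin n → A) :
    (disj l).HT M Z Y e ↔ ∃ F ∈ l, F.HT M Z Y e := by
  induction l with
  | nil => simp [disj, HT]
  | cons F l ih => simp only [disj] at ih; simp [disj, HT, ih]

theorem FOForm.ht_closeAll {n : ℕ} (F : FOForm σ n) (e : Fin 0 → A) :
    F.closeAll.HT M Z Y e ↔ ∀ x, F.HT M Z Y x := by
  induction n with
  | zero => exact ⟨fun h x => Subsingleton.elim e x ▸ h, fun h => h e⟩
  | succ n ih =>
    simp only [closeAll, ih, HT]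
    exact ⟨fun h x => Fin.cons_self_tail x ▸ h (Fin.tail x) (x 0), fun h _ _ => h _⟩

theorem SOForm.sat_conj (X : Interp σ A) {n : ℕ} (l : List (SOForm σ n)) (e : Fin n → A) :
    (conj l).Sat M X e ↔ ∀ F ∈ l, F.Sat M X e := by
  induction l with
  | nil => simp [conj, neg, Sat]
  | cons F l ih => simp only [conj] at ih; simp [conj, Sat, ih]

theorem SOForm.sat_disj (X : Interp σ A) {n : ℕ} (l : List (SOForm σ n)) (e : Fin n → A) :
    (disj l).Sat M X e ↔ ∃ F ∈ l, F.Sat M X e := by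
  induction l with
  | nil => simp [disj, Sat]
  | cons F l ih => simp only [disj] at ih; simp [disj, Sat, ih]

theorem SOForm.sat_closeAll (X : Interp σ A) {n : ℕ} (F : SOForm σ n) (e : Fin 0 → A) :
    F.closeAll.Sat M X e ↔ ∀ x, F.Sat M X x := by
  induction n with
  | zero => exact ⟨fun h x => Subsingleton.elim e x ▸ h, fun h => h e⟩
  | succ n ih =>
    simp only [closeAll, ih, Sat]
    exact ⟨fun h x => Fin.cons_self_tail x ▸ h (Fin.tail x) (x 0), fun h _ _ => h _⟩

theorem SOForm.sat_closeEx (X : Interp σ A) {n : ℕ} (F : SOForm σ n) (e : Fin 0 → A) :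
    F.closeEx.Sat M X e ↔ ∃ x, F.Sat M X x := by
  induction n with
  | zero => exact ⟨fun h => ⟨e, h⟩, fun ⟨x, h⟩ => Subsingleton.elim e x ▸ h⟩
  | succ n ih =>
    simp only [closeEx, ih, Sat]
    exact ⟨fun ⟨_, _, h⟩ => ⟨_, h⟩,
      fun ⟨x, h⟩ => ⟨Fin.tail x, x 0, (Fin.cons_self_tail x).symm ▸ h⟩⟩

theorem SOForm.sat_exPs (L : List σ.Pred) (X : Interp σ A) {n : ℕ} (F : SOForm σ n)
    (e : Fin n → A) :
    (exPs L F).Sat M X e ↔ ∃ Y : Interp σ A, (∀ p ∉ L, Y p = X p) ∧ F.Sat M Y e := by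
  classical
  induction L generalizing X with
  | nil =>
    constructor
    · exact fun h => ⟨X, fun _ _ => rfl, h⟩
    · rintro ⟨Y, hY, h⟩
      obtain rfl : Y = X := funext fun p => hY p List.not_mem_nil
      exact h
  | cons q L ih =>
    simp only [exPs] at ih
    simp only [exPs, List.foldr_cons, Sat, ih]
    constructor
    · rintro ⟨R, Y, hY, h⟩
      refine ⟨Y, fun p hp => ?_, h⟩
      rw [List.mem_cons, not_or] at hp
      rw [hY p hp.2, Function.update_of_ne hp.1]
    · rintro ⟨Y, hY, h⟩
      refine ⟨Y q, Y, fun p hp => ?_, h⟩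
      by_cases hpq : p = q
      · subst hpq
        simp
      · rw [Function.update_of_ne hpq, hY p (by simp [hpq, hp])]

theorem SOForm.sat_ltPreds (L : List σ.Pred) (X : Interp σ A) (e : Fin 0 → A) :
    (ltPreds L).Sat M X e ↔
      (∀ p ∈ L, ∀ x, X p x → M.pred p x) ∧ ∃ p ∈ L, ∃ x, M.pred p x ∧ ¬ X p x := by
  simp [ltPreds, Sat, sat_conj, sat_disj, leAt, neAt, sat_closeAll, sat_closeEx, neg, Term.val]

/-- Second-order quantification over the predicate variables in `L` becomes quantification over the
interpretations that differ from the structure on `L` only. -/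
theorem sat_stable (ψ : FOForm σ 0) (L : List σ.Pred) (X : Interp σ A) (e : Fin 0 → A) :
    (stable ψ L).Sat M X e ↔ ψ.HT M M.pred M.pred e ∧
      ∀ Y : Interp σ A, (∀ p ∉ L, Y p = M.pred p) → (∀ p x, Y p x → M.pred p x) →
        ψ.HT M M.pred Y e → ∀ p x, M.pred p x → Y p x := by
  simp only [stable, SOForm.Sat, SOForm.neg, SOForm.sat_exPs, SOForm.sat_ltPreds,
    FOForm.sat_toSO, FOForm.sat_circle]
  refine and_congr_right fun _ => ⟨fun h Y hY hle hψ p x hx => ?_, ?_⟩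
  · by_contra hn
    have hmix : ∀ X', (∀ q ∈ L, X' q = Y q) → mix M L X' = Y := fun X' hX' => by
      funext q
      by_cases hq : q ∈ L
      · rw [mix_of_mem hq, hX' q hq]
      · rw [mix_of_notMem hq, hY q hq]
    classical
    have hmem : p ∈ L := by
      by_contra hp
      exact hn (hY p hp ▸ hx)
    refine h ⟨fun q => if q ∈ L then Y q else X q, fun q hq => if_neg hq, ⟨fun q hq => ?_, ?_⟩, ?_⟩
    · simpa only [if_pos hq] using hle q
    · exact ⟨p, hmem, x, hx, by simpa only [if_pos hmem] using hn⟩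
    · rwa [hmix _ fun q hq => if_pos hq]
  · rintro h ⟨Y, -, ⟨hle, p, hp, x, hx, hn⟩, hψ⟩
    have := h (mix M L Y) (fun q hq => mix_of_notMem hq) (fun q x => ?_) hψ p x hx
    · rw [mix_of_mem hp] at this
      exact hn this
    · by_cases hq : q ∈ L
      · rw [mix_of_mem hq]
        exact hle q hq x
      · rw [mix_of_notMem hq]
        exact id

theorem sat_parCirc (Θ : FOForm σ 0) (Ps Qs : List σ.Pred) (X : Interp σ A) (e : Fin 0 → A) :
    (parCirc Θ Ps Qs).Sat M X e ↔ Θ.HT M M.pred M.pred e ∧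
      ∀ Y : Interp σ A, (∀ p ∉ Ps ++ Qs, Y p = M.pred p) →
        (∀ p ∈ Ps, ∀ x, Y p x → M.pred p x) →
        Θ.HT M Y Y e → ∀ p ∈ Ps, ∀ x, M.pred p x → Y p x := by
  simp only [parCirc, SOForm.Sat, SOForm.neg, SOForm.sat_exPs, SOForm.sat_ltPreds,
    FOForm.sat_toSO, FOForm.sat_subst]
  refine and_congr_right fun _ => ⟨fun h Y hY hle hΘ p hp x hx => ?_, ?_⟩
  · by_contra hn
    classical
    have hPs : ∀ q ∈ Ps, q ∈ Ps ++ Qs := fun q hq => List.mem_append_left _ hq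
    refine h ⟨fun q => if q ∈ Ps ++ Qs then Y q else X q, fun q hq => if_neg hq, ?_,
      fun q hq => ?_, ?_⟩
    · convert hΘ using 1 <;>
      · funext q
        by_cases hq : q ∈ Ps ++ Qs
        · rw [mix_of_mem hq, if_pos hq]
        · rw [mix_of_notMem hq, hY q hq]
    · simpa only [if_pos (hPs q hq)] using hle q hq
    · exact ⟨p, hp, x, hx, by simpa only [if_pos (hPs p hp)] using hn⟩
  · rintro h ⟨Y, -, hΘ, hle, p, hp, x, hx, hn⟩
    have hmix : ∀ q ∈ Ps, mix M (Ps ++ Qs) Y q = Y q := fun q hq =>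
      mix_of_mem (List.mem_append_left _ hq)
    have := h (mix M (Ps ++ Qs) Y) (fun q hq => mix_of_notMem hq)
      (fun q hq => by rw [hmix q hq]; exact hle q hq) hΘ p hp x hx
    rw [hmix p hp] at this
    exact hn this

/-! ### Rules and reducts -/

/-- Truth of an atom under the interpretation `Y` of the predicates. -/
def Atom.Holds (M : Struc σ A) (Y : Interp σ A) {n : ℕ} (e : Fin n → A) : Atom σ n → Prop
  | .eq s t => s.val M e = t.val M e
  | .pred p ts => Y p (fun i => (ts i).val M e)

/-- `Y` satisfies the reduct of the rule at `Z`: the negated atoms are read in `Z` and all the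
others in `Y`. -/
def RuleSat (M : Struc σ A) (Z Y : Interp σ A) (r : Rule σ) : Prop :=
  ∀ e, (∀ a ∈ r.pos, a.Holds M Y e) → (∀ a ∈ r.neg, ¬ a.Holds M Z e) →
    ∃ a ∈ r.head, a.Holds M Y e

theorem Atom.ht_form {n : ℕ} (a : Atom σ n) (e : Fin n → A) :
    a.form.HT M Z Y e ↔ a.Holds M Y e := by
  cases a <;> rfl

theorem Atom.Holds.mono (h : ∀ p x, Y p x → Z p x) {n : ℕ} {a : Atom σ n} {e : Fin n → A}
    (ha : a.Holds M Y e) : a.Holds M Z e := by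
  cases a with
  | eq s t => exact ha
  | pred p ts => exact h _ _ ha

/-- For `Y ≤ Z`, an atom that is false "there" is also false "here", so that a negated atom is
read in `Z` at both worlds. -/
theorem FOForm.ht_ruleForm (h : ∀ p x, Y p x → Z p x) (r : Rule σ) (e : Fin 0 → A) :
    r.form.HT M Z Y e ↔ RuleSat M Z Y r ∧ RuleSat M Z Z r := by
  have key : ∀ W : Interp σ A, (∀ p x, W p x → Z p x) → ∀ x : Fin r.nvars → A,
      ((FOForm.conj (r.pos.map Atom.form ++ r.neg.map (fun a => a.form.neg))).HT M Z W x →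
        (FOForm.disj (r.head.map Atom.form)).HT M Z W x) ↔
      ((∀ a ∈ r.pos, a.Holds M W x) → (∀ a ∈ r.neg, ¬ a.Holds M Z x) →
        ∃ a ∈ r.head, a.Holds M W x) := by
    intro W hW x
    have hneg : ∀ a : Atom σ r.nvars, a.form.neg.HT M Z W x ↔ ¬ a.Holds M Z x := fun a => by
      simp only [FOForm.neg, FOForm.HT, Atom.ht_form]
      exact ⟨fun h => h.2, fun h => ⟨fun h' => h (h'.mono hW), h⟩⟩
    simp only [FOForm.ht_conj, FOForm.ht_disj, List.mem_append, List.mem_map, or_imp,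
      forall_and, forall_exists_index, and_imp, forall_apply_eq_imp_iff₂, exists_exists_and_eq_and,
      Atom.ht_form, hneg]
  simp only [Rule.form, FOForm.ht_closeAll, FOForm.HT, key Y h, key Z (fun _ _ => id), RuleSat,
    forall_and]

theorem FOForm.ht_progForm (h : ∀ p x, Y p x → Z p x) (prog : List (Rule σ)) (e : Fin 0 → A) :
    (progForm prog).HT M Z Y e ↔
      (∀ r ∈ prog, RuleSat M Z Y r) ∧ ∀ r ∈ prog, RuleSat M Z Z r := by
  simp only [progForm, FOForm.ht_conj, List.mem_map, forall_exists_index, and_imp,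
    forall_apply_eq_imp_iff₂, FOForm.ht_ruleForm h, forall_and]

theorem FOForm.ht_progForm_self (prog : List (Rule σ)) (e : Fin 0 → A) :
    (progForm prog).HT M Z Z e ↔ ∀ r ∈ prog, RuleSat M Z Z r := by
  rw [FOForm.ht_progForm (fun _ _ => id), and_self]

end Semantics

/-! ### The rules of a repair program -/

section Repair

variable {S : Schema.{u}} {A : Type v} {M : Struc S.sig A} {Z Y Z' Y' : Interp S.sig A}

/-- The relation over `A` that the database extension of `P` denotes in `M`. -/
def dbRel (M : Struc S.sig A) (D : Instance S) (P : Fin S.numRel) (x : Fin (S.arity P) → A) : Prop :=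
  ∃ a ∈ D P, x = fun i => M.const (a i)

theorem ruleSat_factRules (D : Instance S) :
    (∀ r ∈ factRules D, RuleSat M Z Y r) ↔
      ∀ P x, dbRel M D P x → Y (RPred.ann .base P) x := by
  simp only [factRules, List.mem_flatMap, List.mem_map, List.mem_finRange, Finset.mem_toList,
    true_and, dbRel, forall_exists_index, and_imp]
  constructor
  · rintro h P x a ha rfl
    simpa [Atom.Holds, Term.val] using h _ P a ha rfl Fin.elim0 (by simp) (by simp)
  · rintro h r P a ha rfl e - -
    simpa [Atom.Holds, Term.val] using h P _ a ha rfl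

theorem ruleSat_starRules :
    (∀ r ∈ starRules S, RuleSat M Z Y r) ↔
      ∀ P x, (Y (RPred.ann .base P) x → Y (RPred.ann .star P) x) ∧
        (Y (RPred.ann .t P) x → Y (RPred.ann .star P) x) := by
  simp [starRules, RuleSat, Schema.gen, Atom.Holds, Term.val, or_imp, forall_and]

theorem ruleSat_dstarRules :
    (∀ r ∈ dstarRules S, RuleSat M Z Y r) ↔
      ∀ P x, Y (RPred.ann .star P) x → ¬ Z (RPred.ann .f P) x → Y (RPred.ann .dstar P) x := by
  simp [dstarRules, RuleSat, Schema.gen, Atom.Holds, Term.val]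

theorem ruleSat_denialRules :
    (∀ r ∈ denialRules S, RuleSat M Z Y r) ↔
      ∀ P x, Y (RPred.ann .t P) x → ¬ Y (RPred.ann .f P) x := by
  simp [denialRules, RuleSat, Schema.gen, Atom.Holds, Term.val]

theorem ruleSat_coreRules (ics : List (IC S)) (D : Instance S) :
    (∀ r ∈ coreRules ics D, RuleSat M Z Y r) ↔
      (∀ r ∈ factRules D, RuleSat M Z Y r) ∧ (∀ ic ∈ ics, ∀ r ∈ ic.rules, RuleSat M Z Y r) ∧
        ∀ r ∈ starRules S, RuleSat M Z Y r := by
  simp only [coreRules, List.mem_append, List.mem_flatMap, or_imp, forall_and,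
    forall_exists_index, and_imp, and_assoc]
  exact and_congr_right fun _ => and_congr_left fun _ =>
    ⟨fun h ic hic r hr => h r ic hic hr, fun h r ic hic hr => h ic hic r hr⟩

theorem ruleSat_repairProgram (ics : List (IC S)) (D : Instance S) :
    (∀ r ∈ repairProgram ics D, RuleSat M Z Y r) ↔
      (∀ r ∈ coreRules ics D, RuleSat M Z Y r) ∧ (∀ r ∈ dstarRules S, RuleSat M Z Y r) ∧
        ∀ r ∈ denialRules S, RuleSat M Z Y r := by
  simp only [repairProgram, List.mem_append, or_imp, forall_and, and_assoc]

theorem BAtom.holds_congr (h : ∀ b, Y (RPred.builtIn b) = Y' (RPred.builtIn b)) {n : ℕ}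
    (a : BAtom S n) (e : Fin n → A) : a.atom.Holds M Y e ↔ a.atom.Holds M Y' e := by
  cases a with
  | eq s t => exact Iff.rfl
  | builtIn b ts => simp only [BAtom.atom, Atom.Holds, h]

/-- In the reduct of a constraint rule, `P` is read only "there", `P_t`, `P_f` only "here", and
`P⋆` only "here" and in the body, so that it may shrink. -/
theorem RuleSat.of_icRules {ics : List (IC S)}
    (h : ∀ ic ∈ ics, ∀ r ∈ ic.rules, RuleSat M Z Y r)
    (hb : ∀ P, Z' (RPred.ann .base P) = Z (RPred.ann .base P))
    (hZ : ∀ b, Z' (RPred.builtIn b) = Z (RPred.builtIn b))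
    (hY : ∀ b, Y' (RPred.builtIn b) = Y (RPred.builtIn b))
    (ht : ∀ P, Y' (RPred.ann .t P) = Y (RPred.ann .t P))
    (hf : ∀ P, Y' (RPred.ann .f P) = Y (RPred.ann .f P))
    (hs : ∀ P x, Y' (RPred.ann .star P) x → Y (RPred.ann .star P) x) :
    ∀ ic ∈ ics, ∀ r ∈ ic.rules, RuleSat M Z' Y' r := by
  intro ic hic r hr
  have h := h ic hic r hr
  simp only [IC.rules, List.mem_map] at hr
  obtain ⟨s, -, rfl⟩ := hr
  intro e hpos hneg
  simp only [RuleSat, List.mem_append, List.mem_map, or_imp, or_and_right, forall_and, exists_or,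
    forall_exists_index, and_imp, forall_apply_eq_imp_iff₂, exists_exists_and_eq_and] at h hpos hneg ⊢
  have hT : ∀ q : DBAtom S ic.nvars, (q.ann .t).Holds M Y' e ↔ (q.ann .t).Holds M Y e :=
    fun q => by simp only [DBAtom.ann, Atom.Holds, ht]
  have hF : ∀ q : DBAtom S ic.nvars, (q.ann .f).Holds M Y' e ↔ (q.ann .f).Holds M Y e :=
    fun q => by simp only [DBAtom.ann, Atom.Holds, hf]
  have hB : ∀ q : DBAtom S ic.nvars, (q.ann .base).Holds M Z' e ↔ (q.ann .base).Holds M Z e :=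
    fun q => by simp only [DBAtom.ann, Atom.Holds, hb]
  simp only [hT, hF, hB, BAtom.holds_congr hY, BAtom.holds_congr hZ] at hpos hneg ⊢
  exact h e (fun q hq => hs _ _ (hpos.1.1 q hq)) hpos.1.2 hpos.2 hneg.1 hneg.2

theorem ht_completion (D : Instance S) (e : Fin 0 → A) :
    (completion D).HT M Z Z e ↔ ∀ P x, Z (RPred.ann .base P) x ↔ dbRel M D P x := by
  simp only [completion, FOForm.ht_conj, FOForm.ht_disj, FOForm.ht_closeAll, List.mem_map,
    List.mem_finRange, Finset.mem_toList, true_and, forall_exists_index,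
    forall_apply_eq_imp_iff, FOForm.iff, FOForm.HT, Atom.ht_form, and_self,
    exists_exists_and_eq_and, Term.val, Schema.gen, Atom.Holds, dbRel, funext_iff]
  exact forall₂_congr fun P x => ⟨fun h => ⟨h.1, fun ⟨a, ha⟩ => h.2 a ha⟩,
    fun h => ⟨h.1, fun a ha => h.2 ⟨a, ha⟩⟩⟩

theorem ht_starDef (e : Fin 0 → A) :
    (starDef S).HT M Z Z e ↔ ∀ P x,
      (Z (RPred.ann .base P) x ∨ Z (RPred.ann .t P) x) ↔ Z (RPred.ann .star P) x := by
  simp only [starDef, FOForm.ht_conj, FOForm.ht_closeAll, List.mem_map,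
    List.mem_finRange, true_and, forall_exists_index,
    forall_apply_eq_imp_iff, FOForm.iff, FOForm.HT, Atom.ht_form, and_self,
    Term.val, ← iff_iff_implies_and_implies, Schema.gen, Atom.Holds]

theorem ht_dstarDef (e : Fin 0 → A) :
    (dstarDef S).HT M Z Z e ↔ ∀ P x,
      (Z (RPred.ann .star P) x ∧ ¬ Z (RPred.ann .f P) x) ↔ Z (RPred.ann .dstar P) x := by
  simp only [dstarDef, FOForm.ht_conj, FOForm.ht_closeAll, List.mem_map,
    List.mem_finRange, true_and, forall_exists_index, FOForm.neg,
    forall_apply_eq_imp_iff, FOForm.iff, FOForm.HT, Atom.ht_form, and_self, imp_false,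
    Term.val, ← iff_iff_implies_and_implies, Schema.gen, Atom.Holds]

theorem ht_denials (e : Fin 0 → A) :
    (denials S).HT M Z Z e ↔ ∀ P x, Z (RPred.ann .t P) x → ¬ Z (RPred.ann .f P) x := by
  simp only [denials, FOForm.ht_conj, FOForm.ht_closeAll, List.mem_map,
    List.mem_finRange, true_and, forall_exists_index, FOForm.neg,
    forall_apply_eq_imp_iff, FOForm.HT, Atom.ht_form, and_self, imp_false, not_and,
    Term.val, Schema.gen, Atom.Holds]

theorem mem_annPreds {as : List Ann} {p : RPred S} :
    p ∈ S.annPreds as ↔ ∃ P, ∃ a ∈ as, RPred.ann a P = p := by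
  simp [Schema.annPreds]

/-- The interpretation that differs from `Z` at the database predicates, where it is given by `V`. -/
def withAnn (Z : Interp S.sig A)
    (V : Ann → (P : Fin S.numRel) → (Fin (S.arity P) → A) → Prop) : Interp S.sig A
  | .ann a P => V a P
  | .builtIn b => Z (RPred.builtIn b)

/-! ### Stable models of repair programs -/

theorem sat_repairSentence_iff (ics : List (IC S)) (D : Instance S) (X : Interp S.sig A)
    (e : Fin 0 → A) :
    (repairSentence ics D).Sat M X e ↔
      (∀ r ∈ repairProgram ics D, RuleSat M M.pred M.pred r) ∧
      ∀ Y : Interp S.sig A, (∀ b, Y (RPred.builtIn b) = M.pred (RPred.builtIn b)) →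
        (∀ p x, Y p x → M.pred p x) → (∀ r ∈ repairProgram ics D, RuleSat M M.pred Y r) →
        ∀ p x, M.pred p x → Y p x := by
  rw [repairSentence, sat_stable, FOForm.ht_progForm_self]
  refine and_congr_right fun hM => forall_congr' fun Y => ?_
  have : (∀ p ∉ S.annPreds [.base, .t, .f, .star, .dstar], Y p = M.pred p) ↔
      ∀ b, Y (RPred.builtIn b) = M.pred (RPred.builtIn b) := by
    refine ⟨fun h b => h _ (by simp [mem_annPreds]), fun h p hp => ?_⟩
    cases p with
    | builtIn b => exact h b
    | ann a P => exact absurd (mem_annPreds.2 ⟨P, a, by cases a <;> simp, rfl⟩) hp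
  rw [this]
  refine imp_congr_right fun _ => forall_congr' fun hle => ?_
  rw [FOForm.ht_progForm hle, and_iff_left hM]

theorem sat_repairCirc_iff (ics : List (IC S)) (D : Instance S) (X : Interp S.sig A)
    (e : Fin 0 → A) :
    (repairCirc ics D).Sat M X e ↔
      (∀ r ∈ coreRules ics D, RuleSat M M.pred M.pred r) ∧
      ∀ Y : Interp S.sig A, (∀ b, Y (RPred.builtIn b) = M.pred (RPred.builtIn b)) →
        (∀ P, Y (RPred.ann .base P) = M.pred (RPred.ann .base P)) →
        (∀ P, Y (RPred.ann .dstar P) = M.pred (RPred.ann .dstar P)) →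
        (∀ P x, Y (RPred.ann .t P) x → M.pred (RPred.ann .t P) x) →
        (∀ P x, Y (RPred.ann .f P) x → M.pred (RPred.ann .f P) x) →
        (∀ r ∈ coreRules ics D, RuleSat M Y Y r) →
        (∀ P x, M.pred (RPred.ann .t P) x → Y (RPred.ann .t P) x) ∧
          ∀ P x, M.pred (RPred.ann .f P) x → Y (RPred.ann .f P) x := by
  rw [repairCirc, sat_parCirc, FOForm.ht_progForm_self]
  have hmem : ∀ R : RPred S → Prop, (∀ p ∈ S.annPreds [.t, .f], R p) ↔
      (∀ P, R (.ann .t P)) ∧ ∀ P, R (.ann .f P) := fun R => by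
    simp only [mem_annPreds, List.mem_cons, List.not_mem_nil, or_false]
    constructor
    · exact fun h => ⟨fun P => h _ ⟨P, _, .inl rfl, rfl⟩, fun P => h _ ⟨P, _, .inr rfl, rfl⟩⟩
    · rintro ⟨h₁, h₂⟩ p ⟨P, a, rfl | rfl, rfl⟩
      exacts [h₁ P, h₂ P]
  refine and_congr_right fun hM => forall_congr' fun Y => ?_
  have hnot : (∀ p ∉ S.annPreds [.t, .f] ++ S.annPreds [.star], Y p = M.pred p) ↔
      (∀ b, Y (RPred.builtIn b) = M.pred (RPred.builtIn b)) ∧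
      (∀ P, Y (RPred.ann .base P) = M.pred (RPred.ann .base P)) ∧
      ∀ P, Y (RPred.ann .dstar P) = M.pred (RPred.ann .dstar P) := by
    simp only [List.mem_append, mem_annPreds]
    constructor
    · exact fun h => ⟨fun b => h _ (by simp), fun P => h _ (by simp), fun P => h _ (by simp)⟩
    · rintro ⟨h₁, h₂, h₃⟩ p hp
      cases p with
      | builtIn b => exact h₁ b
      | ann a P => cases a <;> first | exact h₂ P | exact h₃ P | simp at hp
  rw [hnot, hmem (fun p => ∀ x, Y p x → M.pred p x), hmem (fun p => ∀ x, M.pred p x → Y p x),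
    FOForm.ht_progForm_self]
  simp only [and_imp]

theorem sat_repairSentence (ics : List (IC S)) (D : Instance S) (X : Interp S.sig A)
    (e : Fin 0 → A) :
    (repairSentence ics D).Sat M X e ↔
      (completion D).toSO.Sat M X e ∧ (starDef S).toSO.Sat M X e ∧
        (dstarDef S).toSO.Sat M X e ∧ (denials S).toSO.Sat M X e ∧
          (repairCirc ics D).Sat M X e := by
  simp only [FOForm.sat_toSO, sat_repairSentence_iff, sat_repairCirc_iff, ht_completion,
    ht_starDef, ht_dstarDef, ht_denials, ruleSat_repairProgram, ruleSat_coreRules,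
    ruleSat_factRules, ruleSat_starRules, ruleSat_dstarRules, ruleSat_denialRules]
  constructor
  · rintro ⟨⟨⟨hfact, hic, hstar⟩, hdstar, hden⟩, hmin⟩
    -- One submodel of the reduct gives the completion and both definitions.
    have hsub := hmin (withAnn M.pred fun
        | .base, P => dbRel M D P
        | .t, P => M.pred (RPred.ann .t P)
        | .f, P => M.pred (RPred.ann .f P)
        | .star, P => fun x => dbRel M D P x ∨ M.pred (RPred.ann .t P) x
        | .dstar, P => fun x =>
            (dbRel M D P x ∨ M.pred (RPred.ann .t P) x) ∧ ¬ M.pred (RPred.ann .f P) x)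
      (fun _ => rfl)
      (by
        have hs : ∀ P x, dbRel M D P x ∨ M.pred (RPred.ann .t P) x →
            M.pred (RPred.ann .star P) x := fun P x h =>
          h.elim (fun h => (hstar P x).1 (hfact P x h)) (hstar P x).2
        rintro (⟨_ | _ | _ | _ | _, P⟩ | b) x h
        exacts [hfact P x h, h, h, hs P x h, hdstar P x (hs P x h.1) h.2, h])
      ⟨⟨fun _ _ => id, RuleSat.of_icRules hic (fun _ => rfl) (fun _ => rfl) (fun _ => rfl)
        (fun _ => rfl) (fun _ => rfl)
        (fun P x h => h.elim (fun h => (hstar P x).1 (hfact P x h)) (hstar P x).2),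
        fun _ _ => ⟨.inl, .inr⟩⟩, fun _ _ => .intro, hden⟩
    have hbase : ∀ P x, M.pred (RPred.ann .base P) x ↔ dbRel M D P x := fun P x =>
      ⟨hsub (RPred.ann .base P) x, hfact P x⟩
    have hstar' : ∀ P x, (M.pred (RPred.ann .base P) x ∨ M.pred (RPred.ann .t P) x) ↔
        M.pred (RPred.ann .star P) x := fun P x =>
      ⟨fun h => h.elim (hstar P x).1 (hstar P x).2,
        fun h => (hsub (RPred.ann .star P) x h).imp_left (hbase P x).2⟩
    refine ⟨hbase, hstar', fun P x => ⟨fun h => hdstar P x h.1 h.2, fun h => ?_⟩, hden,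
      ⟨hfact, hic, hstar⟩, ?_⟩
    · obtain ⟨h₁, h₂⟩ := hsub (RPred.ann .dstar P) x h
      exact ⟨(hstar' P x).1 (h₁.imp_left (hbase P x).2), h₂⟩
    · rintro Y hYb hYbase - hYt hYf ⟨-, hYic, hYstar⟩
      -- `P⋆` varies freely in the circumscription; the least choice lies below the structure.
      have hsub' := hmin (withAnn M.pred fun
          | .base, P => M.pred (RPred.ann .base P)
          | .t, P => Y (RPred.ann .t P)
          | .f, P => Y (RPred.ann .f P)
          | .star, P => fun x => M.pred (RPred.ann .base P) x ∨ Y (RPred.ann .t P) x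
          | .dstar, P => M.pred (RPred.ann .dstar P))
        (fun _ => rfl)
        (by
          rintro (⟨_ | _ | _ | _ | _, P⟩ | b) x h
          exacts [h, hYt P x h, hYf P x h, (hstar' P x).1 (h.imp_right (hYt P x)), h, h])
        ⟨⟨hfact, RuleSat.of_icRules hYic (fun P => (hYbase P).symm) (fun b => (hYb b).symm)
          (fun b => (hYb b).symm) (fun _ => rfl) (fun _ => rfl)
          (fun P x h => h.elim (fun h => (hYstar P x).1 (hYbase P ▸ h)) (hYstar P x).2),
          fun _ _ => ⟨.inl, .inr⟩⟩,
          fun P x h => hdstar P x ((hstar' P x).1 (h.imp_right (hYt P x))),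
          fun P x h₁ h₂ => hden P x (hYt P x h₁) (hYf P x h₂)⟩
      exact ⟨fun P => hsub' (RPred.ann .t P), fun P => hsub' (RPred.ann .f P)⟩
  · rintro ⟨hbase, hstar, hdstar, hden, ⟨hfact, hic, hstar'⟩, hcirc⟩
    refine ⟨⟨⟨hfact, hic, hstar'⟩, fun P x h₁ h₂ => (hdstar P x).1 ⟨h₁, h₂⟩, hden⟩, ?_⟩
    rintro Y hYb hle ⟨⟨hYfact, hYic, hYstar⟩, hYdstar, -⟩
    have hYbase : ∀ P, Y (RPred.ann .base P) = M.pred (RPred.ann .base P) := fun P =>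
      funext fun x => propext ⟨hle (RPred.ann .base P) x, fun h => hYfact P x ((hbase P x).1 h)⟩
    -- `P⋆⋆` is fixed in the circumscription and does not occur in its theory, so it is reset.
    obtain ⟨ht, hf⟩ := hcirc (withAnn M.pred fun
          | .dstar, P => M.pred (RPred.ann .dstar P)
          | a, P => Y (RPred.ann a P))
      (fun _ => rfl) hYbase (fun _ => rfl) (fun P => hle _) (fun P => hle _)
      ⟨hYfact, RuleSat.of_icRules hYic hYbase (fun _ => rfl) (fun b => (hYb b).symm) (fun _ => rfl)
        (fun _ => rfl) (fun _ _ => id), hYstar⟩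
    have hs : ∀ P x, M.pred (RPred.ann .star P) x → Y (RPred.ann .star P) x := fun P x h =>
      ((hstar P x).2 h).elim (fun h => (hYstar P x).1 ((hYbase P).symm ▸ h))
        (fun h => (hYstar P x).2 (ht P x h))
    rintro (⟨_ | _ | _ | _ | _, P⟩ | b) x h
    · exact (hYbase P).symm ▸ h
    · exact ht P x h
    · exact hf P x h
    · exact hs P x h
    · obtain ⟨h₁, h₂⟩ := (hdstar P x).2 h
      exact hYdstar P x (hs P x h₁) h₂
    · exact (hYb b).symm ▸ h

end Repair

end RepairSO

theorem proposition2 (S : RepairSO.Schema.{u}) (ics : List (RepairSO.IC S))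
    (D : RepairSO.Instance S) :
    (∀ C : Finset S.Const, (∀ P, ∀ a ∈ D P, ∀ i, a i ∈ C) →
      RepairSO.LogEquiv.{u, v}
        ((RepairSO.domainClosure S C).toSO.and
          ((RepairSO.uniqueNames S C).toSO.and (RepairSO.repairSentence ics D)))
        ((RepairSO.reconstruction D C).toSO.and
          ((RepairSO.starDef S).toSO.and
            ((RepairSO.dstarDef S).toSO.and
              ((RepairSO.denials S).toSO.and (RepairSO.repairCirc ics D)))))) ∧
    RepairSO.LogEquiv.{u, v}
      (RepairSO.repairSentence ics D)
      ((RepairSO.completion D).toSO.and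
        ((RepairSO.starDef S).toSO.and
          ((RepairSO.dstarDef S).toSO.and
            ((RepairSO.denials S).toSO.and (RepairSO.repairCirc ics D))))) := by
  refine ⟨fun C _ A _ M X => ?_, fun A _ M X => ?_⟩
  · simp only [RepairSO.reconstruction, RepairSO.SOForm.Sat, RepairSO.FOForm.toSO,
      RepairSO.FOForm.subst]
    rw [RepairSO.sat_repairSentence]
    simp only [RepairSO.FOForm.toSO]
    tauto
  · simp only [RepairSO.SOForm.Sat]
    exact RepairSO.sat_repairSentence ics D X _
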